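/- Let $\mathbb{R}^3_1$ be $\mathbb{R}^3$ with the scalar product $\langle x,y\rangle=-x_0y_0+x_1y_1+x_2y_2$, let $U\subset\mathbb{R}^2$ be open, and let $f:U\to\mathbb{R}^3_1$ be a $C^\infty$ immersion whose set $L(f)$ of lightlike points (points where the tangent plane is the orthogonal complement of a nonzero null vector) is non-empty. Suppose that all points of $L(f)$ are of the first kind: if $E,F,G$ are the coefficients of the induced metric $\langle df,df\rangle$ and $\lambda=EG-F^2$, then at each $q\in L(f)$ one has $d\lambda_q\neq0$ and $d\lambda_q(\eta)\ne0$ for every nonzero vector $\eta$ in the kernel of the induced metric at $q$. Let $\gamma:(-\varepsilon,\varepsilon)\to L(f)$ be a smooth curve, $\hat\gamma=f\circ\gamma$, parametrized so that $\langle\hat\gamma',\hat\gamma'\rangle=1$ (so $\gamma$ parametrizes $L(f)$ near $\gamma(0)$), and put $e=\hat\gamma'$. Let $\{e,L,N\}$ be a smooth frame along $\hat\gamma$ with $$\langle e,L\rangle=\langle e,N\rangle=\langle L,L\rangle=\langle N,N\rangle=0,\qquad \langle L,N\rangle=1,$$ such that $e(u),L(u)$ span the tangent plane of $f$ at $\gamma(u)$.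 Let $l$ be a smooth vector field on $U$ with $df(l)=L$ along $\gamma$, let $\beta$ be the function $l\langle df(l),df(l)\rangle$ (the derivative of $\langle df(l),df(l)\rangle$ in the direction $l$) along $\gamma$, which does not vanish, and let $$\kappa_L=\beta^{-1/3}\langle\hat\gamma'',L\rangle,\qquad \kappa_N=\beta^{1/3}\langle\hat\gamma'',N\rangle$$ (real cube roots) be the lightlike singular curvature and the lightlike normal curvature. With $\widetilde v=v/v_0$ for $v=(v_0,v_1,v_2)$, $v_0\neq0$, the osculating and the transversal lightcone pedal of $f$ are the curves $$LP_L(u)=\langle\hat\gamma(u),\widetilde{L(u)}\rangle\,\widetilde{L(u)},\qquad LP_N(u)=\langle\hat\gamma(u),\widetilde{N(u)}\rangle\,\widetilde{N(u)}.$$ (L) If $\langle\hat\gamma(0),L(0)\rangle\neq0$, i.e. $LP_L(0)\ne0$, then $LP_L$ is singular at $u=0$ (that is, $LP_L'(0)=0$) if and only if $\kappa_L(0)=0$; and $LP_L$ has a cusp at $u=0$ if and only if $\kappa_L(0)=0$ and $\kappa_L'(0)\neq0$. (N) If $\langle\hat\gamma(0),N(0)\rangle\neq0$, i.e. $LP_N(0)\ne0$,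 then $LP_N$ is singular at $u=0$ if and only if $\kappa_N(0)=0$; and $LP_N$ has a cusp at $u=0$ if and only if $\kappa_N(0)=0$ and $\kappa_N'(0)\neq0$. Here a curve germ in $\mathbb{R}^3$ has a cusp if, up to $C^\infty$ diffeomorphism germs of the source and of the target, it is the germ $t\mapsto(t^2,t^3,0)$ at $t=0$. -/

import Mathlib

open scoped ContDiff Topology

noncomputable section

namespace MixedSurface

/-- The parameter plane. -/
abbrev Plane := Fin 2 → ℝ

/-- The underlying vector space of the Lorentz-Minkowski space, with coordinates `x 0, x 1, x 2`,
where `x 0` is the time coordinate. -/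
abbrev Mink := Fin 3 → ℝ

/-- The Lorentzian scalar product of signature `(-, +, +)`. -/
def lor (x y : Mink) : ℝ := -(x 0 * y 0) + x 1 * y 1 + x 2 * y 2

/-- Lightlike vectors: nonzero and null. -/
def IsLightlikeVec (x : Mink) : Prop := x ≠ 0 ∧ lor x x = 0

/-- A plane is lightlike if it is the Lorentz-orthogonal complement of a lightlike vector. -/
def IsLightlikePlane (P : Submodule ℝ Mink) : Prop :=
  ∃ x : Mink, IsLightlikeVec x ∧ ∀ y : Mink, y ∈ P ↔ lor x y = 0

/-- `f` is a smooth immersion of the open set `U`. -/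
structure IsSmoothImmersion (f : Plane → Mink) (U : Set Plane) : Prop where
  isOpen : IsOpen U
  smooth : ContDiffOn ℝ ∞ f U
  injective : ∀ q ∈ U, Function.Injective (fderiv ℝ f q)

/-- The tangent plane of `f` at `q`. -/
def tangentPlane (f : Plane → Mink) (q : Plane) : Submodule ℝ Mink :=
  LinearMap.range (fderiv ℝ f q : Plane →ₗ[ℝ] Mink)

/-- The set of lightlike points of an immersion `f` of `U`. -/
def lightlikeSet (f : Plane → Mink) (U : Set Plane) : Set Plane :=
  {q | q ∈ U ∧ IsLightlikePlane (tangentPlane f q)}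

/-- The induced metric (first fundamental form) of `f` at `q`. -/
def inducedMetric (f : Plane → Mink) (q v w : Plane) : ℝ :=
  lor (fderiv ℝ f q v) (fderiv ℝ f q w)

/-- The discriminant `E G - F ^ 2` of the induced metric. -/
def discriminant (f : Plane → Mink) (q : Plane) : ℝ :=
  inducedMetric f q ![1, 0] ![1, 0] * inducedMetric f q ![0, 1] ![0, 1]
    - inducedMetric f q ![1, 0] ![0, 1] ^ 2

/-- A nonzero vector `η` in the kernel of the induced metric at `q`. -/
def IsNullDirection (f : Plane → Mink) (q η : Plane) : Prop :=
  η ≠ 0 ∧ ∀ w : Plane, inducedMetric f q η w = 0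

/-- A lightlike point `q` is of the first kind if it is non-degenerate (the discriminant of the
induced metric has nonzero differential at `q`, so that near `q` the lightlike points form a
regular curve whose tangent line at `q` is the kernel of that differential), and the null
direction at `q` is transverse to that curve. -/
def IsFirstKind (f : Plane → Mink) (q : Plane) : Prop :=
  fderiv ℝ (discriminant f) q ≠ 0 ∧
    ∀ η : Plane, IsNullDirection f q η → fderiv ℝ (discriminant f) q η ≠ 0

/-- `γ`, on `(-ε, ε)`, is a smooth curve of lightlike points of `f` such that `f ∘ γ` is a
spacelike curve with unit speed. -/
structure IsLightlikeLocusParam (f : Plane → Mink) (U : Set Plane) (ε : ℝ) (γ : ℝ → Plane) :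
    Prop where
  pos : 0 < ε
  smooth : ContDiffOn ℝ ∞ γ (Set.Ioo (-ε) ε)
  mem : ∀ u ∈ Set.Ioo (-ε) ε, γ u ∈ lightlikeSet f U
  unit : ∀ u ∈ Set.Ioo (-ε) ε, lor (deriv (f ∘ γ) u) (deriv (f ∘ γ) u) = 1

/-- `{e, L, N}`, with `e = (f ∘ γ)'`, is a smooth frame along the lightlike locus `f ∘ γ`: `L` and
`N` are null, orthogonal to `e`, with `⟨L, N⟩ = 1`, and `e, L` span the tangent plane of `f`. -/
structure IsLightlikeFrame (f : Plane → Mink) (ε : ℝ) (γ : ℝ → Plane) (L N : ℝ → Mink) :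
    Prop where
  smooth_L : ContDiffOn ℝ ∞ L (Set.Ioo (-ε) ε)
  smooth_N : ContDiffOn ℝ ∞ N (Set.Ioo (-ε) ε)
  e_L : ∀ u ∈ Set.Ioo (-ε) ε, lor (deriv (f ∘ γ) u) (L u) = 0
  e_N : ∀ u ∈ Set.Ioo (-ε) ε, lor (deriv (f ∘ γ) u) (N u) = 0
  L_L : ∀ u ∈ Set.Ioo (-ε) ε, lor (L u) (L u) = 0
  L_N : ∀ u ∈ Set.Ioo (-ε) ε, lor (L u) (N u) = 1
  N_N : ∀ u ∈ Set.Ioo (-ε) ε, lor (N u) (N u) = 0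
  span_eq : ∀ u ∈ Set.Ioo (-ε) ε,
    Submodule.span ℝ {deriv (f ∘ γ) u, L u} = tangentPlane f (γ u)

/-- `l` is a smooth vector field on `U` with `df(l) = L` along `γ`. -/
structure IsNullFieldFor (f : Plane → Mink) (U : Set Plane) (ε : ℝ) (γ : ℝ → Plane)
    (L : ℝ → Mink) (l : Plane → Plane) : Prop where
  smooth : ContDiffOn ℝ ∞ l U
  map_eq : ∀ u ∈ Set.Ioo (-ε) ε, fderiv ℝ f (γ u) (l (γ u)) = L u

/-- `⟨(f ∘ γ)'', V⟩`: this is `α_L` for `V = L` and `α_N` for `V = N`. -/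
def alpha (f : Plane → Mink) (γ : ℝ → Plane) (V : ℝ → Mink) (u : ℝ) : ℝ :=
  lor (deriv (deriv (f ∘ γ)) u) (V u)

/-- `β = l⟨df(l), df(l)⟩` along `γ`: the derivative of the function `⟨df(l), df(l)⟩` in the
direction `l`. -/
def beta (f : Plane → Mink) (γ : ℝ → Plane) (l : Plane → Plane) (u : ℝ) : ℝ :=
  fderiv ℝ (fun q => inducedMetric f q (l q) (l q)) (γ u) (l (γ u))

/-- The real cube root, of either sign. -/
def cbrt (x : ℝ) : ℝ := SignType.sign x * |x| ^ (1 / 3 : ℝ)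

theorem cbrt_pow_three (x : ℝ) : cbrt x ^ 3 = x := by
  have h : (|x| ^ (1 / 3 : ℝ)) ^ 3 = |x| := by
    rw [← Real.rpow_natCast, ← Real.rpow_mul (abs_nonneg x)]
    norm_num
  rw [cbrt, mul_pow, h]
  rcases lt_trichotomy x 0 with hx | hx | hx
  · rw [sign_neg hx, abs_of_neg hx]
    norm_num
  · simp [hx]
  · rw [sign_pos hx, abs_of_pos hx]
    norm_num

/-- The lightlike singular curvature `κ_L = β^{-1/3} α_L`. -/
def kappaL (f : Plane → Mink) (γ : ℝ → Plane) (L : ℝ → Mink) (l : Plane → Plane) (u : ℝ) : ℝ :=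
  (cbrt (beta f γ l u))⁻¹ * alpha f γ L u

/-- The lightlike normal curvature `κ_N = β^{1/3} α_N`. -/
def kappaN (f : Plane → Mink) (γ : ℝ → Plane) (N : ℝ → Mink) (l : Plane → Plane) (u : ℝ) : ℝ :=
  cbrt (beta f γ l u) * alpha f γ N u

/-- The normalization `v / v₀` of a vector with `v₀ ≠ 0`. -/
def tilde (v : Mink) : Mink := (v 0)⁻¹ • v

/-- The lightcone pedal `⟨c, Ṽ⟩ Ṽ`: osculating for `c = f ∘ γ`, `V = L`, and transversal for
`c = f ∘ γ`, `V = N`. -/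
def lightconePedal (c V : ℝ → Mink) (u : ℝ) : Mink :=
  lor (c u) (tilde (V u)) • tilde (V u)

/-- The curve `c` is differentiable at `u` and its velocity vanishes there. -/
def IsSingularParam (c : ℝ → Mink) (u : ℝ) : Prop := DifferentiableAt ℝ c u ∧ deriv c u = 0

/-- A local diffeomorphism of class `C^∞` in both directions. -/
def IsSmoothLocalDiffeo {E : Type*} [NormedAddCommGroup E] [NormedSpace ℝ E]
    (φ : OpenPartialHomeomorph E E) : Prop :=
  ContDiffOn ℝ ∞ φ φ.source ∧ ContDiffOn ℝ ∞ φ.symm φ.target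

/-- The germs of curves `c₁` at `t₁` and `c₂` at `t₂` are `𝒜`-equivalent: they agree up to smooth
diffeomorphism germs of the source and of the target. -/
def AEquivalent (c₁ : ℝ → Mink) (t₁ : ℝ) (c₂ : ℝ → Mink) (t₂ : ℝ) : Prop :=
  ∃ (φ : OpenPartialHomeomorph ℝ ℝ) (Φ : OpenPartialHomeomorph Mink Mink),
    IsSmoothLocalDiffeo φ ∧ IsSmoothLocalDiffeo Φ ∧
    t₁ ∈ φ.source ∧ φ t₁ = t₂ ∧ c₁ t₁ ∈ Φ.source ∧ Φ (c₁ t₁) = c₂ t₂ ∧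
    ∀ᶠ t in 𝓝 t₁, c₁ t ∈ Φ.source ∧ Φ (c₁ t) = c₂ (φ t)

/-- `c` has a (`3/2`-)cusp at `u`. -/
def HasCuspAt (c : ℝ → Mink) (u : ℝ) : Prop :=
  AEquivalent c u (fun t => ![t ^ 2, t ^ 3, 0]) 0

end MixedSurface

end

open MixedSurface

/-!
The osculating and the transversal pedal are treated alike: each is the lightcone pedal of a unit
speed spacelike curve `c` with a null normal field `V`. The normalization `v` of `V` runs on the
circle of null directions `(1, cos θ, sin θ)`, so `v' = σ T` with the angular velocity `σ = θ'`
and the unit tangent `T` of the circle. As `c'` is orthogonal to `V`, the pedal `⟨c, v⟩ v` has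
velocity `σ m` with `m = ⟨c, T⟩ v + ⟨c, v⟩ T`, and `⟨c'', V⟩ = -⟨c', V'⟩ = -V₀ σ ⟨c', T⟩`, where
`⟨c', T⟩ = ±1`. Hence the pedal is singular exactly where `⟨c'', V⟩` vanishes. At a zero of `σ`
one has `m' = ⟨c', T⟩ v`, which is independent of `m` because `⟨c, v⟩ ≠ 0`; so the second and
third derivatives of the pedal are independent if `σ' ≠ 0`, and the second derivative vanishes if
`σ' = 0` (`exists_lightconePedal_factorization`).

A curve with `c' = 0` whose second and third derivatives are independent has a cusp
(`hasCuspAt_zero_of_linearIndependent`). This rests on the decomposition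
`c t = P (t ^ 2) + t ^ 3 • Q (t ^ 2)` with smooth `P` and `Q` (`exists_eq_sq_add_cube_smul`), which is proved with Borel's
lemma (`exists_contDiff_isBigO`) and the smoothness of `r (√y) / √y ^ k` for flat functions `r`
(`IsFlat.contDiff_sqrt`). Conversely, at a cusp the velocity vanishes and the acceleration does
not.

The curvatures `κ_L` and `κ_N` differ from `⟨c'', L⟩` and `⟨c'', N⟩` by powers of `β`, which are
differentiable and nonzero because all lightlike points are of the first kind (`beta_ne_zero`).
-/

open Asymptotics Filter
open scoped ContDiff Topology

/-! ### Borel's lemma and even functions -/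

section Whitney

variable {E : Type*} [NormedAddCommGroup E] [NormedSpace ℝ E]

theorem isBigO_sub_taylor {f : ℝ → E} (hf : ContDiff ℝ ∞ f) (n : ℕ) :
    (fun t => f t - ∑ i ∈ Finset.range n, t ^ i • ((i.factorial : ℝ)⁻¹ • iteratedDeriv i f 0))
      =O[𝓝 0] fun t : ℝ => t ^ n := by
  have h := (taylor_isLittleO_univ (x₀ := 0) (n := n)
    (hf.of_le (by exact_mod_cast le_top))).isBigO
  have h2 : (fun t : ℝ => t ^ n • ((n.factorial : ℝ)⁻¹ • iteratedDeriv n f 0))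
      =O[𝓝 0] fun t : ℝ => t ^ n := by
    simpa using (isBigO_refl (fun t : ℝ => t ^ n) (𝓝 0)).smul
      (isBigO_const_const ((n.factorial : ℝ)⁻¹ • iteratedDeriv n f 0) (one_ne_zero' ℝ) (𝓝 0))
  simp only [sub_zero] at h
  refine (h.add h2).congr_left fun t => ?_
  rw [taylor_within_apply, Finset.sum_range_succ]
  simp only [iteratedDerivWithin_univ, sub_zero, smul_smul, mul_comm]
  abel

theorem iteratedDeriv_eq_zero_of_isBigO {f : ℝ → E} (hf : ContDiff ℝ ∞ f)
    (h : ∀ n : ℕ, f =O[𝓝 0] fun t : ℝ => t ^ n) (n : ℕ) : iteratedDeriv n f 0 = 0 := by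
  induction n using Nat.strong_induction_on with
  | _ n ih =>
    have h1 := isBigO_sub_taylor hf (n + 1)
    have h2 := (h (n + 1)).sub h1
    have h3 : (fun t : ℝ => t ^ n • ((n.factorial : ℝ)⁻¹ • iteratedDeriv n f 0))
        =O[𝓝 0] fun t : ℝ => t ^ (n + 1) := by
      refine h2.congr_left fun t => ?_
      rw [Finset.sum_range_succ, Finset.sum_eq_zero]
      · simp
      · intro i hi
        rw [ih i (Finset.mem_range.1 hi)]
        simp
    have h4 : (fun t : ℝ => t ^ (n + 1)) =o[𝓝 0] fun t : ℝ => t ^ n :=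
      isLittleO_pow_pow (𝕜 := ℝ) n.lt_succ_self
    have h5 := h3.trans_isLittleO h4
    generalize hv : (n.factorial : ℝ)⁻¹ • iteratedDeriv n f 0 = v at h5
    have h6 : v = 0 := by
      by_contra hne
      have h7 : (fun t : ℝ => t ^ n) =O[𝓝 0] fun t : ℝ => t ^ n • v := by
        refine IsBigO.of_bound ‖v‖⁻¹ (Eventually.of_forall fun t => ?_)
        rw [norm_smul]
        have := norm_pos_iff.2 hne
        rw [mul_left_comm, inv_mul_cancel₀ this.ne', mul_one]
      have h8 := (h7.trans_isLittleO h5).mono (nhdsWithin_le_nhds (s := {0}ᶜ))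
      have h9 := (isLittleO_irrefl' (f' := fun t : ℝ => t ^ n) (l := 𝓝[≠] (0 : ℝ)) ?_) h8
      · exact h9
      · refine (eventually_mem_nhdsWithin.mono fun t ht => ?_).frequently
        exact norm_ne_zero_iff.2 (pow_ne_zero n ht)
    have : (n.factorial : ℝ)⁻¹ ≠ 0 := by positivity
    exact (smul_eq_zero.1 (hv.trans h6)).resolve_left this

/-- A smooth function on the line is flat at the origin if all of its derivatives vanish there. -/
structure IsFlat (r : ℝ → E) : Prop where
  contDiff : ContDiff ℝ ∞ r
  iteratedDeriv_eq_zero : ∀ n, iteratedDeriv n r 0 = 0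

namespace IsFlat

variable {r s : ℝ → E}

theorem deriv (h : IsFlat r) : IsFlat (deriv r) where
  contDiff := ((contDiff_infty_iff_deriv).1 h.contDiff).2
  iteratedDeriv_eq_zero n := by
    rw [← iteratedDeriv_succ']; exact h.iteratedDeriv_eq_zero _

theorem apply_zero (h : IsFlat r) : r 0 = 0 := by simpa using h.iteratedDeriv_eq_zero 0

theorem isBigO (h : IsFlat r) (n : ℕ) : r =O[𝓝 0] fun t : ℝ => t ^ n := by
  refine (isBigO_sub_taylor h.contDiff n).congr_left fun t => ?_
  simp [h.iteratedDeriv_eq_zero]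

theorem of_isBigO (hr : ContDiff ℝ ∞ r) (h : ∀ n : ℕ, r =O[𝓝 0] fun t : ℝ => t ^ n) : IsFlat r :=
  ⟨hr, iteratedDeriv_eq_zero_of_isBigO hr h⟩

theorem comp_neg (h : IsFlat r) : IsFlat fun t => r (-t) := by
  refine of_isBigO (h.contDiff.comp contDiff_neg) fun n => ?_
  have h1 : Tendsto (fun t : ℝ => -t) (𝓝 0) (𝓝 0) := by simpa using tendsto_neg (0 : ℝ)
  refine ((h.isBigO n).comp_tendsto h1).trans (IsBigO.of_bound 1 (Eventually.of_forall fun t => ?_))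
  simp

theorem add (hr : IsFlat r) (hs : IsFlat s) : IsFlat fun t => r t + s t :=
  of_isBigO (hr.contDiff.add hs.contDiff) fun n => (hr.isBigO n).add (hs.isBigO n)

theorem sub (hr : IsFlat r) (hs : IsFlat s) : IsFlat fun t => r t - s t :=
  of_isBigO (hr.contDiff.sub hs.contDiff) fun n => (hr.isBigO n).sub (hs.isBigO n)

theorem const_smul (hr : IsFlat r) (a : ℝ) : IsFlat fun t => a • r t :=
  of_isBigO (hr.contDiff.const_smul a) fun n => (hr.isBigO n).const_smul_left a

/-- Differentiating `r (√y) / √y ^ k` produces functions of the same form. At `y ≤ 0` all of them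
vanish, because `√y = 0` and `r 0 = 0`; at `y = 0` this uses that `r` decays faster than any
power. -/
theorem hasDerivAt_sqrt (h : IsFlat r) (k : ℕ) (y : ℝ) :
    HasDerivAt (fun y => (√y)⁻¹ ^ k • r √y)
      ((1 / 2 : ℝ) • ((√y)⁻¹ ^ (k + 1) • _root_.deriv r √y)
        - (k / 2 : ℝ) • ((√y)⁻¹ ^ (k + 2) • r √y)) y := by
  rcases le_or_gt y 0 with hy | hy
  · rw [Real.sqrt_eq_zero'.2 hy, h.apply_zero, h.deriv.apply_zero]
    simp only [smul_zero, sub_zero]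
    rcases hy.lt_or_eq with hy | rfl
    · refine (hasDerivAt_const y (0 : E)).congr_of_eventuallyEq ?_
      filter_upwards [Iio_mem_nhds hy] with z hz
      rw [Real.sqrt_eq_zero'.2 (le_of_lt hz), h.apply_zero, smul_zero]
    · rw [hasDerivAt_iff_isLittleO]
      simp only [Real.sqrt_zero, h.apply_zero, smul_zero, sub_zero]
      have h0 : Tendsto (fun y : ℝ => √y) (𝓝 0) (𝓝 0) := by
        simpa using Real.continuous_sqrt.tendsto 0
      have h1 := (h.isBigO (k + 4)).comp_tendsto h0
      have h2 : (fun y : ℝ => (√y)⁻¹ ^ k • r √y) =O[𝓝 0] fun y : ℝ => y ^ 2 := by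
        obtain ⟨C, hC0, hC⟩ := h1.exists_pos
        refine IsBigO.of_bound C ?_
        filter_upwards [hC.bound] with y hy
        rcases le_or_gt y 0 with hy0 | hy0
        · rw [Real.sqrt_eq_zero'.2 hy0, h.apply_zero]
          simp only [smul_zero, norm_zero]
          positivity
        · have hs := Real.sqrt_pos.2 hy0
          simp only [Function.comp, norm_pow, Real.norm_eq_abs, abs_of_pos hs, abs_of_pos hy0,
            norm_smul, norm_inv] at hy ⊢
          calc (√y)⁻¹ ^ k * ‖r √y‖ ≤ (√y)⁻¹ ^ k * (C * √y ^ (k + 4)) := by gcongr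
            _ = C * (√y ^ 2) ^ 2 := by rw [inv_pow, pow_add]; field_simp
            _ = C * y ^ 2 := by rw [Real.sq_sqrt hy0.le]
      exact h2.trans_isLittleO (by
        simpa using isLittleO_pow_pow (𝕜 := ℝ) (m := 1) (n := 2) (by norm_num))
  · have hs := Real.sqrt_pos.2 hy
    have h1 := Real.hasDerivAt_sqrt hy.ne'
    have h2 := (h1.inv hs.ne').pow k
    have h3 := ((h.contDiff.differentiable (by simp)) √y).hasDerivAt.scomp y h1
    refine (h2.smul h3).congr_deriv ?_
    rw [sub_eq_add_neg, ← neg_smul, smul_smul, smul_smul, smul_smul]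
    congr 1
    · congr 1
      simp only [Pi.pow_apply, Pi.inv_apply, pow_succ, one_div, mul_inv]
      ring
    · simp only [Function.comp, Pi.inv_apply]
      congr 1
      rcases k with _ | k
      · simp
      · simp only [Nat.add_sub_cancel, inv_pow]
        field_simp
        ring

theorem contDiff_sqrt (h : IsFlat r) (k : ℕ) : ContDiff ℝ ∞ fun y => (√y)⁻¹ ^ k • r √y := by
  refine contDiff_infty.2 fun n => ?_
  induction n generalizing r k with
  | zero =>
    exact contDiff_zero.2 (continuous_iff_continuousAt.2 fun y =>
      (h.hasDerivAt_sqrt k y).continuousAt)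
  | succ n ih =>
    rw [Nat.cast_succ, contDiff_succ_iff_deriv]
    refine ⟨fun y => (h.hasDerivAt_sqrt k y).differentiableAt, by simp, ?_⟩
    rw [funext fun y => (h.hasDerivAt_sqrt k y).deriv]
    exact ((ih h.deriv (k + 1)).const_smul _).sub ((ih h (k + 2)).const_smul _)

/-- A flat function is the sum of its even part, a smooth function of `t ^ 2`, and its odd part,
`t ^ 3` times a smooth function of `t ^ 2`. -/
theorem exists_eq_add (h : IsFlat r) : ∃ P Q : ℝ → E, ContDiff ℝ ∞ P ∧ ContDiff ℝ ∞ Q ∧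
    ∀ t, r t = P (t ^ 2) + t ^ 3 • Q (t ^ 2) := by
  have he := (h.add h.comp_neg).const_smul (1 / 2)
  have ho := (h.sub h.comp_neg).const_smul (1 / 2)
  refine ⟨_, _, he.contDiff_sqrt 0, ho.contDiff_sqrt 3, fun t => ?_⟩
  simp only [Real.sqrt_sq_eq_abs, pow_zero, one_smul]
  rcases lt_trichotomy t 0 with ht | rfl | ht
  · rw [abs_of_neg ht, neg_neg, smul_smul]
    have : t ^ 3 * (-t)⁻¹ ^ 3 = -1 := by
      rw [inv_pow, Odd.neg_pow (by decide), inv_neg, mul_neg, mul_inv_cancel₀ (pow_ne_zero 3 ht.ne)]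
    rw [this]
    module
  · simp [h.apply_zero]
  · rw [abs_of_pos ht, smul_smul]
    have : t ^ 3 * t⁻¹ ^ 3 = 1 := by field_simp
    rw [this]
    module

end IsFlat

/-- **Borel's lemma**: every sequence of coefficients is the Taylor expansion at the origin of a
smooth function. -/
theorem exists_contDiff_isBigO [CompleteSpace E] (a : ℕ → E) : ∃ b : ℝ → E, ContDiff ℝ ∞ b ∧
    ∀ n : ℕ, (fun y => b y - ∑ i ∈ Finset.range n, y ^ i • a i) =O[𝓝 0] fun y : ℝ => y ^ n := by
  -- The sum of the series `u i = χ (Λ i * x) * x ^ i • a i`, with a cut-off function `χ`.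
  let χ : ContDiffBump (0 : ℝ) := ⟨1 / 2, 1, by norm_num, by norm_num⟩
  have hχ1 : ∀ x, |χ x| ≤ 1 := fun x => by rw [abs_of_nonneg χ.nonneg]; exact χ.le_one
  have hχ0 : ∀ x : ℝ, 1 ≤ |x| → χ x = 0 := fun x hx => χ.zero_of_le_dist (by simpa using hx)
  have hχe : ∀ᶠ x in 𝓝 (0 : ℝ), χ x = 1 := χ.eventuallyEq_one
  let ψ : ℕ → ℝ → ℝ := fun i x => χ x * x ^ i
  have hψ : ∀ i, ContDiff ℝ ∞ (ψ i) := fun i => χ.contDiff.mul (contDiff_id.pow i)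
  have hψc : ∀ i, HasCompactSupport (ψ i) := fun i => χ.hasCompactSupport.mul_right
  have hM : ∀ i k, ∃ M, ∀ x, ‖iteratedFDeriv ℝ k (ψ i) x‖ ≤ M := fun i k =>
    ((hψc i).iteratedFDeriv k).exists_bound_of_continuous
      ((hψ i).continuous_iteratedFDeriv (by exact_mod_cast le_top))
  choose M hM using hM
  -- The scale `Λ i` is so large that the rescaled `i`-th term has its derivatives of order `< i`
  -- bounded by `2⁻ⁱ`.
  let Λ : ℕ → ℝ := fun i => 1 + 2 ^ i * ‖a i‖ * (1 + ∑ k ∈ Finset.range i, M i k)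
  have hM0 : ∀ i k, 0 ≤ M i k := fun i k => (norm_nonneg _).trans (hM i k 0)
  have hΛ1 : ∀ i, 1 ≤ Λ i := fun i => by
    have : 0 ≤ ∑ k ∈ Finset.range i, M i k := Finset.sum_nonneg fun k _ => hM0 i k
    simp only [Λ]
    have : 0 ≤ 2 ^ i * ‖a i‖ * (1 + ∑ k ∈ Finset.range i, M i k) := by positivity
    linarith
  have hΛM : ∀ i k, k < i → ‖a i‖ * M i k ≤ Λ i * (1 / 2) ^ i := fun i k hk => by
    have h1 : M i k ≤ 1 + ∑ k ∈ Finset.range i, M i k := by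
      have := Finset.single_le_sum (f := M i) (fun k _ => hM0 i k) (Finset.mem_range.2 hk)
      linarith
    calc ‖a i‖ * M i k ≤ ‖a i‖ * (1 + ∑ k ∈ Finset.range i, M i k) := by gcongr
      _ = (2 ^ i * ‖a i‖ * (1 + ∑ k ∈ Finset.range i, M i k)) * (1 / 2) ^ i := by
        rw [one_div, inv_pow]; field_simp
      _ ≤ _ := by gcongr; simp only [Λ]; linarith
  have hΛa : ∀ i, ‖a i‖ ≤ Λ i * (1 / 2) ^ i := fun i => by
    have h1 : (1 : ℝ) ≤ 1 + ∑ k ∈ Finset.range i, M i k := by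
      have : 0 ≤ ∑ k ∈ Finset.range i, M i k := Finset.sum_nonneg fun k _ => hM0 i k
      linarith
    calc ‖a i‖ ≤ ‖a i‖ * (1 + ∑ k ∈ Finset.range i, M i k) :=
          le_mul_of_one_le_right (norm_nonneg _) h1
      _ = (2 ^ i * ‖a i‖ * (1 + ∑ k ∈ Finset.range i, M i k)) * (1 / 2) ^ i := by
        rw [one_div, inv_pow]; field_simp
      _ ≤ _ := by gcongr; simp only [Λ]; linarith
  let u : ℕ → ℝ → E := fun i x => ((Λ i)⁻¹ ^ i * ψ i (Λ i * x)) • a i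
  have hu : ∀ i x, u i x = (χ (Λ i * x) * x ^ i) • a i := fun i x => by
    have := (zero_lt_one.trans_le (hΛ1 i)).ne'
    simp only [u, ψ, mul_pow, inv_pow]
    congr 1
    field_simp
  have hud : ∀ i, ContDiff ℝ ∞ (u i) := fun i =>
    (contDiff_const.mul ((hψ i).comp (contDiff_const.mul contDiff_id))).smul contDiff_const
  have hbound : ∀ i k, k < i → ∀ x, ‖iteratedFDeriv ℝ k (u i) x‖ ≤ (1 / 2 : ℝ) ^ i := by
    intro i k hk x
    have h0 := zero_lt_one.trans_le (hΛ1 i)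
    have h1 : iteratedDeriv k (u i) x
        = ((Λ i)⁻¹ ^ i * (Λ i ^ k * iteratedDeriv k (ψ i) (Λ i * x))) • a i := by
      have hg : ContDiffAt ℝ k (fun x => ψ i (Λ i * x)) x :=
        (((hψ i).comp (contDiff_const.mul contDiff_id)).of_le
          (by exact_mod_cast le_top)).contDiffAt
      rw [iteratedDeriv_smul_const (contDiffAt_const.mul hg), iteratedDeriv_const_mul_field,
        iteratedDeriv_comp_const_mul ((hψ i).of_le (by exact_mod_cast le_top))]
    rw [norm_iteratedFDeriv_eq_norm_iteratedDeriv, h1, norm_smul]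
    have h2 : |iteratedDeriv k (ψ i) (Λ i * x)| ≤ M i k := by
      rw [← Real.norm_eq_abs, ← norm_iteratedFDeriv_eq_norm_iteratedDeriv]; exact hM i k _
    have h3 : (Λ i)⁻¹ ^ i * Λ i ^ k ≤ (Λ i)⁻¹ := by
      obtain ⟨j, rfl⟩ := Nat.exists_eq_add_of_lt hk
      have key : ∀ c : ℝ, c ≠ 0 → c⁻¹ ^ (k + j + 1) * c ^ k = c⁻¹ ^ j * c⁻¹ := fun c hc => by
        rw [add_assoc k j 1, pow_add _ k (j + 1), mul_right_comm, ← mul_pow, inv_mul_cancel₀ hc,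
          one_pow, one_mul, pow_succ]
      rw [key _ h0.ne']
      exact mul_le_of_le_one_left (inv_nonneg.2 h0.le)
        (pow_le_one₀ (inv_nonneg.2 h0.le) (inv_le_one_of_one_le₀ (hΛ1 _)))
    rw [norm_mul, norm_mul, norm_pow, norm_pow, norm_inv, Real.norm_of_nonneg h0.le,
      Real.norm_eq_abs]
    calc _ = (Λ i)⁻¹ ^ i * Λ i ^ k * (|iteratedDeriv k (ψ i) (Λ i * x)| * ‖a i‖) := by ring
      _ ≤ (Λ i)⁻¹ * (M i k * ‖a i‖) := by gcongr
      _ ≤ (Λ i)⁻¹ * (Λ i * (1 / 2) ^ i) := by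
        rw [mul_comm (M i k)]; gcongr ?_ * ?_; exact hΛM i k hk
      _ = _ := by field_simp
  have hsum : Summable fun i : ℕ => (1 / 2 : ℝ) ^ i := summable_geometric_two
  have hsm : ∀ x, Summable fun i => u i x := fun x => by
    refine Summable.of_norm_bounded_eventually_nat hsum ?_
    filter_upwards [eventually_gt_atTop 0] with i hi
    simpa using hbound i 0 hi x
  refine ⟨fun x => ∑' i, u i x, ?_, fun n => ?_⟩
  · refine contDiff_tsum_of_eventually hud (v := fun _ i => (1 / 2 : ℝ) ^ i) (fun _ _ => hsum) ?_
    intro k _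
    rw [Nat.cofinite_eq_atTop]
    filter_upwards [eventually_gt_atTop k] with i hi
    exact hbound i k hi
  · -- On the support of `χ (Λ i * x)`, each factor `Λ i * |x|` is at most one.
    have htail : ∀ i x, n < i → ‖u i x‖ ≤ |x| ^ n * (1 / 2) ^ i := by
      intro i x hi
      have h0 := zero_lt_one.trans_le (hΛ1 i)
      rw [hu, norm_smul, norm_mul, norm_pow, Real.norm_eq_abs, Real.norm_eq_abs]
      rcases le_or_gt 1 |Λ i * x| with hx | hx
      · rw [hχ0 _ hx]; simp
      · obtain ⟨j, rfl⟩ := Nat.exists_eq_add_of_lt hi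
        rw [abs_mul, abs_of_pos h0] at hx
        have hx' : |x| ≤ 1 := le_trans (le_mul_of_one_le_left (abs_nonneg x) (hΛ1 _)) hx.le
        calc |χ (Λ (n + j + 1) * x)| * |x| ^ (n + j + 1) * ‖a (n + j + 1)‖
            ≤ 1 * |x| ^ (n + j + 1) * (Λ (n + j + 1) * (1 / 2) ^ (n + j + 1)) := by
              gcongr
              · exact hχ1 _
              · exact hΛa _
          _ = |x| ^ n * (|x| ^ j * (Λ (n + j + 1) * |x|)) * (1 / 2) ^ (n + j + 1) := by ring
          _ ≤ |x| ^ n * (1 * 1) * (1 / 2) ^ (n + j + 1) := by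
              gcongr
              exact pow_le_one₀ (abs_nonneg x) hx'
          _ = _ := by ring
    have hhead : ∀ᶠ x in 𝓝 (0 : ℝ), ∀ i ∈ Finset.range (n + 1), u i x = x ^ i • a i := by
      rw [Filter.eventually_all_finset]
      intro i _
      have h1 : Tendsto (fun x : ℝ => Λ i * x) (𝓝 0) (𝓝 0) := by
        simpa using tendsto_id.const_mul (b := Λ i) (x := 𝓝 (0 : ℝ))
      filter_upwards [h1.eventually hχe] with x hx
      rw [hu, hx, one_mul]
    refine IsBigO.of_bound (‖a n‖ + 2) ?_
    filter_upwards [hhead] with x hx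
    rw [← (hsm x).sum_add_tsum_nat_add (n + 1), Finset.sum_congr rfl hx, Finset.sum_range_succ]
    have h1 : ‖∑' i, u (i + (n + 1)) x‖ ≤ |x| ^ n * 2 := by
      refine tsum_of_norm_bounded (hasSum_geometric_two.mul_left _) fun i => ?_
      refine (htail _ x (by omega)).trans ?_
      gcongr |x| ^ n * ?_
      exact pow_le_pow_of_le_one (by norm_num) (by norm_num) (by omega)
    rw [add_assoc, add_sub_cancel_left]
    refine (norm_add_le _ _).trans ?_
    rw [norm_smul, norm_pow, Real.norm_eq_abs]
    linarith

theorem sum_range_even_add_odd (a : ℕ → E) (ha : a 1 = 0) (t : ℝ) (n : ℕ) :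
    ∑ i ∈ Finset.range (2 * n + 2), t ^ i • a i
      = ∑ i ∈ Finset.range (n + 1), (t ^ 2) ^ i • a (2 * i)
        + t ^ 3 • ∑ i ∈ Finset.range n, (t ^ 2) ^ i • a (2 * i + 3) := by
  induction n with
  | zero => simp [Finset.sum_range_succ, ha]
  | succ n ih =>
    rw [Finset.sum_range_succ _ (n + 1),
      Finset.sum_range_succ (fun i => (t ^ 2) ^ i • a (2 * i + 3)) n,
      show 2 * (n + 1) + 2 = 2 * n + 2 + 1 + 1 by ring, Finset.sum_range_succ,
      Finset.sum_range_succ _ (2 * n + 2), ih, smul_add, smul_smul,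
      show t ^ 3 * (t ^ 2) ^ n = t ^ (2 * n + 2 + 1) by ring,
      show (t ^ 2) ^ (n + 1) = t ^ (2 * n + 2) by ring]
    simp only [show 2 * (n + 1) = 2 * n + 2 by ring]
    abel

/-- A smooth map without linear term is a combination of `1` and `t ^ 3` with smooth functions of
`t ^ 2` as coefficients: a form of Whitney's theorem on even functions. Borel's lemma provides
coefficients that are right up to a flat remainder, and the remainder is decomposed directly. -/
theorem exists_eq_sq_add_cube_smul [CompleteSpace E] {F : ℝ → E} (hF : ContDiff ℝ ∞ F)
    (h0 : deriv F 0 = 0) : ∃ P Q : ℝ → E, ContDiff ℝ ∞ P ∧ ContDiff ℝ ∞ Q ∧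
      ∀ t, F t = P (t ^ 2) + t ^ 3 • Q (t ^ 2) := by
  let a : ℕ → E := fun i => (i.factorial : ℝ)⁻¹ • iteratedDeriv i F 0
  have ha : a 1 = 0 := by simp [a, iteratedDeriv_one, h0]
  obtain ⟨p, hp, hp'⟩ := exists_contDiff_isBigO fun i => a (2 * i)
  obtain ⟨q, hq, hq'⟩ := exists_contDiff_isBigO fun i => a (2 * i + 3)
  have hsq : Tendsto (fun t : ℝ => t ^ 2) (𝓝 0) (𝓝 0) := by
    simpa using (continuous_pow 2).tendsto (0 : ℝ)
  have hr : IsFlat fun t => F t - p (t ^ 2) - t ^ 3 • q (t ^ 2) := by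
    refine .of_isBigO ((hF.sub (hp.comp (contDiff_id.pow 2))).sub
      ((contDiff_id.pow 3).smul (hq.comp (contDiff_id.pow 2)))) fun n => ?_
    have hmono : ∀ m, n ≤ m → (fun t : ℝ => t ^ m) =O[𝓝 0] fun t : ℝ => t ^ n := fun m hm =>
      IsBigO.of_bound 1 (by
        filter_upwards [Metric.ball_mem_nhds (0 : ℝ) one_pos] with t ht
        rw [one_mul, norm_pow, norm_pow]
        exact pow_le_pow_of_le_one (norm_nonneg t) (by simpa using (mem_ball_zero_iff.1 ht).le) hm)
    have h1 := (isBigO_sub_taylor hF (2 * n + 2)).trans (hmono _ (by omega))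
    have h2 := (((hp' (n + 1)).comp_tendsto hsq).congr_right fun t =>
      (pow_mul t 2 (n + 1)).symm).trans (hmono _ (by omega))
    have h3 := (((isBigO_refl (fun t : ℝ => t ^ 3) (𝓝 0)).smul
      ((hq' n).comp_tendsto hsq)).congr_right fun t => show _ = t ^ (3 + 2 * n) by
        simp only [Function.comp, smul_eq_mul]; ring).trans (hmono _ (by omega))
    refine ((h1.sub h2).sub h3).congr_left fun t => ?_
    have := sum_range_even_add_odd a ha t n
    simp only [a] at this
    simp only [Function.comp, this, a]
    rw [smul_sub]
    abel
  obtain ⟨P, Q, hP, hQ, h⟩ := hr.exists_eq_add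
  refine ⟨fun y => p y + P y, fun y => q y + Q y, hp.add hP, hq.add hQ, fun t => ?_⟩
  have := h t
  rw [sub_sub, sub_eq_iff_eq_add] at this
  rw [this]
  module
end Whitney

/-! ### Local diffeomorphisms and smooth germs -/

section LocalDiffeo

/-- The inverse function theorem in the smooth category: near a point where its derivative is
invertible, a smooth map is a local diffeomorphism. -/
theorem exists_isSmoothLocalDiffeo {E : Type*} [NormedAddCommGroup E] [NormedSpace ℝ E]
    [CompleteSpace E] {Ψ : E → E} (hΨ : ContDiff ℝ ∞ Ψ) {p : E} (A : E ≃L[ℝ] E)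
    (hA : HasFDerivAt Ψ (A : E →L[ℝ] E) p) :
    ∃ Θ : OpenPartialHomeomorph E E, IsSmoothLocalDiffeo Θ ∧ p ∈ Θ.source ∧ ∀ x, Θ x = Ψ x := by
  -- The local inverse is smooth on the whole target once the source is cut down to the open set `W`
  -- where the derivative is invertible.
  let Θ₀ := hΨ.contDiffAt.toOpenPartialHomeomorph Ψ hA (by simp)
  have hΘ₀ : (Θ₀ : E → E) = Ψ := hΨ.contDiffAt.toOpenPartialHomeomorph_coe hA (by simp)
  let W : Set E := fderiv ℝ Ψ ⁻¹' Set.range ((↑) : (E ≃L[ℝ] E) → E →L[ℝ] E)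
  have hW : IsOpen W := ContinuousLinearEquiv.isOpen.preimage (hΨ.continuous_fderiv (by simp))
  have hΘ : ((Θ₀.restrOpen W hW : OpenPartialHomeomorph E E) : E → E) = Ψ := hΘ₀
  refine ⟨Θ₀.restrOpen W hW, ⟨by rw [hΘ]; exact hΨ.contDiffOn, fun y hy => ?_⟩, ?_,
    fun x => congrFun hΘ x⟩
  · have hx := (Θ₀.restrOpen W hW).map_target hy
    rw [OpenPartialHomeomorph.restrOpen_source] at hx
    obtain ⟨B, hB⟩ := hx.2
    refine ((Θ₀.restrOpen W hW).contDiffAt_symm (f₀' := B) hy ?_ ?_).contDiffWithinAt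
    · rw [hΘ, hB]
      exact (hΨ.differentiable (by simp) _).hasFDerivAt
    · rw [hΘ]
      exact hΨ.contDiffAt
  · rw [OpenPartialHomeomorph.restrOpen_source]
    exact ⟨hΨ.contDiffAt.mem_toOpenPartialHomeomorph_source hA (by simp), A, hA.fderiv.symm⟩

theorem MixedSurface.IsSmoothLocalDiffeo.injective_fderiv {E : Type*}
    [NormedAddCommGroup E] [NormedSpace ℝ E] {φ : OpenPartialHomeomorph E E}
    (h : IsSmoothLocalDiffeo φ) {x : E} (hx : x ∈ φ.source) :
    Function.Injective (fderiv ℝ φ x) := by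
  have h1 := ((h.1.contDiffAt (φ.open_source.mem_nhds hx)).differentiableAt (by simp)).hasFDerivAt
  have h2 := ((h.2.contDiffAt (φ.open_target.mem_nhds (φ.map_source hx))).differentiableAt
    (by simp)).hasFDerivAt
  have h3 : HasFDerivAt (φ.symm ∘ φ) (ContinuousLinearMap.id ℝ E) x := by
    refine (hasFDerivAt_id x).congr_of_eventuallyEq ?_
    filter_upwards [φ.open_source.mem_nhds hx] with y hy using φ.left_inv hy
  have h4 := (h2.comp x h1).unique h3
  exact Function.LeftInverse.injective (g := fderiv ℝ φ.symm (φ x)) fun v => congrArg (· v) h4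

theorem MixedSurface.IsSmoothLocalDiffeo.symm {E : Type*} [NormedAddCommGroup E]
    [NormedSpace ℝ E] {φ : OpenPartialHomeomorph E E} (h : IsSmoothLocalDiffeo φ) :
    IsSmoothLocalDiffeo φ.symm :=
  ⟨h.2, by simpa using h.1⟩

/-- A curve which is smooth near a point has the germ of a curve smooth on the whole line. -/
theorem exists_contDiff_eventuallyEq {E : Type*} [NormedAddCommGroup E] [NormedSpace ℝ E]
    {c : ℝ → E} {s : Set ℝ} {t : ℝ} (hs : s ∈ 𝓝 t) (hc : ContDiffOn ℝ ∞ c s) :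
    ∃ F : ℝ → E, ContDiff ℝ ∞ F ∧ F =ᶠ[𝓝 t] c := by
  obtain ⟨ρ, hρ, hρs⟩ := Metric.mem_nhds_iff.1 hs
  let χ : ContDiffBump t := ⟨ρ / 3, ρ / 2, by positivity, by linarith⟩
  refine ⟨fun x => χ x • c x, contDiff_iff_contDiffAt.2 fun x => ?_, ?_⟩
  · rcases lt_or_ge (dist x t) ρ with hx | hx
    · exact χ.contDiff.contDiffAt.smul ((hc.mono hρs).contDiffAt (Metric.isOpen_ball.mem_nhds hx))
    · refine (contDiffAt_const (c := (0 : E))).congr_of_eventuallyEq ?_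
      have : {y | ρ / 2 < dist y t} ∈ 𝓝 x :=
        (isOpen_lt continuous_const (continuous_id.dist continuous_const)).mem_nhds
          (show ρ / 2 < dist x t by linarith)
      filter_upwards [this] with y hy
      rw [χ.zero_of_le_dist (le_of_lt hy), zero_smul]
  · filter_upwards [χ.eventuallyEq_one] with x hx
    rw [hx, Pi.one_apply, one_smul]

end LocalDiffeo

/-! ### Curves whose velocity has a scalar factor -/

section Leibniz

variable {E : Type*} [NormedAddCommGroup E] [NormedSpace ℝ E]

theorem deriv_deriv_of_deriv_eq_smul {c m : ℝ → E} {σ : ℝ → ℝ} {t : ℝ}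
    (hc : deriv c =ᶠ[𝓝 t] fun u => σ u • m u) (hσ : ContDiffAt ℝ ∞ σ t) (hm : ContDiffAt ℝ ∞ m t)
    (h0 : σ t = 0) : deriv (deriv c) t = deriv σ t • m t := by
  rw [hc.deriv_eq, deriv_fun_smul (hσ.differentiableAt (by simp)) (hm.differentiableAt (by simp)),
    h0, zero_smul, zero_add]

theorem deriv_deriv_deriv_of_deriv_eq_smul {c m : ℝ → E} {σ : ℝ → ℝ} {t : ℝ}
    (hc : deriv c =ᶠ[𝓝 t] fun u => σ u • m u) (hσ : ContDiffAt ℝ ∞ σ t) (hm : ContDiffAt ℝ ∞ m t)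
    (h0 : σ t = 0) : deriv (deriv (deriv c)) t
      = deriv (deriv σ) t • m t + (2 * deriv σ t) • deriv m t := by
  have hσ' : ContDiffAt ℝ ∞ (deriv σ) t := by
    exact (hσ.fderiv_right (m := ∞) (by simp)).clm_apply contDiffAt_const
  have hm' : ContDiffAt ℝ ∞ (deriv m) t := by
    exact (hm.fderiv_right (m := ∞) (by simp)).clm_apply contDiffAt_const
  have h1 : deriv (deriv c) =ᶠ[𝓝 t] fun u => σ u • deriv m u + deriv σ u • m u := by
    filter_upwards [hc.eventually_nhds, 
      (hσ.of_le (m := 1) (by simp)).eventually (by simp),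
      (hm.of_le (m := 1) (by simp)).eventually (by simp)]
      with u hu h1 h2
    rw [EventuallyEq.deriv_eq hu, deriv_fun_smul (h1.differentiableAt (by simp))
      (h2.differentiableAt (by simp))]
  have d1 := hσ.differentiableAt (by simp)
  have d2 := hm.differentiableAt (by simp)
  have d3 := hσ'.differentiableAt (by simp)
  have d4 := hm'.differentiableAt (by simp)
  rw [h1.deriv_eq, deriv_fun_add (d1.fun_smul d4) (d3.fun_smul d2), deriv_fun_smul d1 d4,
    deriv_fun_smul d3 d2, h0]
  module

end Leibniz

/-! ### Cusps -/

section Cusp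

/-- **Recognition of cusps**: a curve with vanishing velocity and independent second and third
derivatives has a cusp. If `c t = P (t ^ 2) + t ^ 3 • Q (t ^ 2)`, then the map `(x, y, z) ↦ P x +
y • Q x + z • w` takes `(t ^ 2, t ^ 3, 0)` to `c t`, and no change of parameter is needed. -/
theorem hasCuspAt_zero_of_linearIndependent {c : ℝ → Mink} {s : Set ℝ} (hs : s ∈ 𝓝 (0 : ℝ))
    (hc : ContDiffOn ℝ ∞ c s) (h1 : deriv c 0 = 0)
    (h : LinearIndependent ℝ ![deriv (deriv c) 0, deriv (deriv (deriv c)) 0]) :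
    HasCuspAt c 0 := by
  obtain ⟨F, hF, hFc⟩ := exists_contDiff_eventuallyEq hs hc
  rw [← hFc.deriv.deriv.deriv_eq, ← hFc.deriv.deriv_eq] at h
  rw [← hFc.deriv_eq] at h1
  obtain ⟨P, Q, hP, hQ, hPQ⟩ := exists_eq_sq_add_cube_smul hF h1
  have hP' := ((contDiff_infty_iff_deriv).1 hP).2
  have hQ' := ((contDiff_infty_iff_deriv).1 hQ).2
  have hsq : ContDiff ℝ ∞ fun t : ℝ => t ^ 2 := contDiff_id.pow 2
  -- The velocity is `t • m t`, which gives the second and third derivatives at the origin.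
  let m : ℝ → Mink := fun t => (2 : ℝ) • deriv P (t ^ 2) +
    t • ((3 : ℝ) • Q (t ^ 2) + (2 * t ^ 2) • deriv Q (t ^ 2))
  have hdF : deriv F = fun t => t • m t := by
    funext t
    have d1 := ((hP.differentiable (by simp) (t ^ 2)).hasDerivAt.scomp t (hasDerivAt_pow 2 t))
    have d2 := ((hQ.differentiable (by simp) (t ^ 2)).hasDerivAt.scomp t (hasDerivAt_pow 2 t))
    have d3 := d1.add ((hasDerivAt_pow 3 t).smul d2)
    have : F = fun t => P (t ^ 2) + t ^ 3 • Q (t ^ 2) := funext hPQ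
    rw [this]
    refine d3.deriv.trans ?_
    simp only [m, Function.comp]
    push_cast
    module
  have hk : ContDiff ℝ ∞ fun t : ℝ => (3 : ℝ) • Q (t ^ 2) + (2 * t ^ 2) • deriv Q (t ^ 2) :=
    ((hQ.comp hsq).const_smul (3 : ℝ)).add ((contDiff_const.mul hsq).smul (hQ'.comp hsq))
  have hm : ContDiff ℝ ∞ m := ((hP'.comp hsq).const_smul (2 : ℝ)).add (contDiff_id.smul hk)
  have hm0 : m 0 = (2 : ℝ) • deriv P 0 := by simp [m]
  have hm1 : deriv m 0 = (3 : ℝ) • Q 0 := by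
    have d1 := ((hP'.differentiable (by simp) ((0 : ℝ) ^ 2)).hasDerivAt.scomp 0
      (hasDerivAt_pow 2 (0 : ℝ)))
    have d2 := (hasDerivAt_id (0 : ℝ)).smul (hk.differentiable (by simp) 0).hasDerivAt
    have d3 := (d1.const_smul (2 : ℝ)).add d2
    refine d3.deriv.trans ?_
    simp
  have e2 := deriv_deriv_of_deriv_eq_smul (σ := id) (hdF.eventuallyEq (l := 𝓝 0)) contDiffAt_id
    hm.contDiffAt rfl
  have e3 := deriv_deriv_deriv_of_deriv_eq_smul (σ := id) (hdF.eventuallyEq (l := 𝓝 0))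
    contDiffAt_id hm.contDiffAt rfl
  simp only [deriv_id', deriv_const', deriv_id, hm0, hm1, mul_one, smul_smul, zero_mul, one_mul,
    zero_smul, zero_add] at e2 e3
  rw [e2, e3] at h
  have hind : LinearIndependent ℝ ![deriv P 0, Q 0] := by
    rw [LinearIndependent.pair_iff] at h ⊢
    intro x y hxy
    have := h (x / 2) (y / 6) (by rw [← hxy]; module)
    constructor <;> linarith [this.1, this.2]
  -- A third vector `w` completes the cuspidal parametrization to a chart `Ψ` of the space.
  obtain ⟨w, hw⟩ := exists_linearIndependent_snoc_of_lt_finrank (R := ℝ) hind (by simp)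
  let b := basisOfLinearIndependentOfCardEqFinrank hw (by simp)
  let A : Mink ≃L[ℝ] Mink := b.equivFun.symm.toContinuousLinearEquiv
  let Ψ : Mink → Mink := fun X => P (X 0) + X 1 • Q (X 0) + X 2 • w
  have hΨ : ContDiff ℝ ∞ Ψ := by fun_prop
  have hA : HasFDerivAt Ψ (A : Mink →L[ℝ] Mink) 0 := by
    have p0 : HasFDerivAt (fun X : Mink => X 0) (ContinuousLinearMap.proj 0) 0 :=
      (ContinuousLinearMap.proj (R := ℝ) (φ := fun _ : Fin 3 => ℝ) 0).hasFDerivAt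
    have p1 : HasFDerivAt (fun X : Mink => X 1) (ContinuousLinearMap.proj 1) 0 :=
      (ContinuousLinearMap.proj (R := ℝ) (φ := fun _ : Fin 3 => ℝ) 1).hasFDerivAt
    have p2 : HasFDerivAt (fun X : Mink => X 2) (ContinuousLinearMap.proj 2) 0 :=
      (ContinuousLinearMap.proj (R := ℝ) (φ := fun _ : Fin 3 => ℝ) 2).hasFDerivAt
    have dP := HasFDerivAt.comp (g := P) (0 : Mink)
      (hP.differentiable (by simp) ((0 : Mink) 0)).hasDerivAt.hasFDerivAt p0
    have dQ := HasFDerivAt.comp (g := Q) (0 : Mink)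
      (hQ.differentiable (by simp) ((0 : Mink) 0)).hasDerivAt.hasFDerivAt p0
    refine ((dP.add (p1.smul dQ)).add (p2.smul_const w)).congr_fderiv ?_
    ext v : 1
    simp [A, Module.Basis.equivFun_symm_apply, Fin.sum_univ_three, b]
  obtain ⟨Θ, hΘ, hΘ0, hΘΨ⟩ := exists_isSmoothLocalDiffeo hΨ A hA
  have hcurve : ∀ t : ℝ, Θ ![t ^ 2, t ^ 3, 0] = F t := fun t => by
    rw [hΘΨ, hPQ]; simp [Ψ]
  have hzero : (![(0 : ℝ) ^ 2, 0 ^ 3, 0] : Mink) = 0 := by ext i; fin_cases i <;> simp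
  have hcont : Continuous fun t : ℝ => (![t ^ 2, t ^ 3, 0] : Mink) := by fun_prop
  have hmem : (![(0 : ℝ) ^ 2, 0 ^ 3, 0] : Mink) ∈ Θ.source := by rwa [hzero]
  refine ⟨.refl ℝ, Θ.symm, ⟨contDiff_id.contDiffOn, contDiff_id.contDiffOn⟩, hΘ.symm,
    Set.mem_univ _, rfl, ?_, ?_, ?_⟩
  · rw [← hFc.eq_of_nhds, ← hcurve]
    exact Θ.map_source hmem
  · rw [← hFc.eq_of_nhds, ← hcurve, Θ.left_inv hmem]
  · filter_upwards [hFc, hcont.continuousAt.preimage_mem_nhds (Θ.open_source.mem_nhds hmem)]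
      with t ht hmt
    rw [← ht, ← hcurve]
    exact ⟨Θ.map_source hmt, Θ.left_inv hmt⟩

/-- At a cusp the velocity vanishes, but the acceleration does not. -/
theorem MixedSurface.HasCuspAt.deriv_eq_zero_and_deriv_deriv_ne_zero {c : ℝ → Mink}
    {t : ℝ} (h : HasCuspAt c t) : DifferentiableAt ℝ c t ∧ deriv c t = 0 ∧ deriv (deriv c) t ≠ 0 := by
  obtain ⟨φ, Φ, hφ, hΦ, ht, hφt, hct, hΦc, hev⟩ := h
  let k : ℝ → Mink := fun s => ![s ^ 2, s ^ 3, 0]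
  have hk : ∀ s, HasDerivAt k (s • ![2, 3 * s, 0]) s := fun s => by
    rw [hasDerivAt_pi]
    intro i
    fin_cases i
    · simpa [k, mul_comm] using hasDerivAt_pow 2 s
    · simpa [k, mul_comm, mul_left_comm, pow_two, mul_assoc] using hasDerivAt_pow 3 s
    · simpa [k] using hasDerivAt_const s (0 : ℝ)
  have hφc := hφ.1.contDiffAt (φ.open_source.mem_nhds ht)
  have hk0 : k (φ t) ∈ Φ.target := by
    rw [hφt, show k 0 = Φ (c t) from hΦc.symm]; exact Φ.map_source hct
  have hkd : ContDiff ℝ ∞ k := contDiff_pi.2 fun i => by fin_cases i <;> simp [k] <;> fun_prop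
  have hcont : ContinuousAt (fun u => k (φ u)) t := hkd.continuous.continuousAt.comp hφc.continuousAt
  have hc : c =ᶠ[𝓝 t] fun u => Φ.symm (k (φ u)) := by
    filter_upwards [hev] with u hu
    rw [show k (φ u) = Φ (c u) from hu.2.symm, Φ.left_inv hu.1]
  let m : ℝ → Mink := fun u =>
    fderiv ℝ Φ.symm (k (φ u)) (deriv φ u • ![2, 3 * φ u, 0])
  have hd : ∀ᶠ u in 𝓝 t, HasDerivAt c (φ u • m u) u := by
    filter_upwards [hc.eventually_nhds, φ.open_source.mem_nhds ht,
      hcont.preimage_mem_nhds (Φ.open_target.mem_nhds hk0)] with u hu hus hut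
    have h1 := ((hφ.1.contDiffAt (φ.open_source.mem_nhds hus)).differentiableAt
      (by simp)).hasDerivAt
    have h2 := ((hΦ.2.contDiffAt (Φ.open_target.mem_nhds hut)).differentiableAt
      (by simp)).hasFDerivAt
    refine ((h2.comp_hasDerivAt u ((hk (φ u)).scomp u h1)).congr_deriv ?_).congr_of_eventuallyEq hu
    simp only [m, map_smul, smul_comm (φ u)]
  have hm : ContDiffAt ℝ ∞ m t := by
    have h1 : ContDiffAt ℝ ∞ (deriv φ) t :=
      (hφc.fderiv_right (m := ∞) (by simp)).clm_apply contDiffAt_const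
    have h2 : ContDiffAt ℝ ∞ (fun u => fderiv ℝ Φ.symm (k (φ u))) t :=
      ((hΦ.2.contDiffAt (Φ.open_target.mem_nhds hk0)).fderiv_right (m := ∞) (by simp)).comp t
        (hkd.contDiffAt.comp t hφc)
    refine h2.clm_apply (h1.smul (contDiffAt_pi.2 fun i => ?_))
    fin_cases i
    · exact contDiffAt_const
    · exact contDiffAt_const.mul hφc
    · exact contDiffAt_const
  have hd0 := hd.self_of_nhds
  rw [hφt, zero_smul] at hd0
  refine ⟨hd0.differentiableAt, hd0.deriv, ?_⟩
  rw [deriv_deriv_of_deriv_eq_smul (hd.mono fun u hu => hu.deriv) hφc hm hφt]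
  have h1 : deriv φ t ≠ 0 := fun h0 => one_ne_zero
    (hφ.injective_fderiv ht ((show fderiv ℝ φ t 1 = 0 from h0).trans (map_zero _).symm))
  refine smul_ne_zero h1 fun h0 => ?_
  have h2 := hΦ.symm.injective_fderiv hk0 (h0.trans (map_zero _).symm)
  simpa [h1] using congrFun h2 0

end Cusp

/-! ### The Lorentzian scalar product -/

section Lorentz

theorem lor_add_left (x y z : Mink) : lor (x + y) z = lor x z + lor y z := by
  simp only [lor, Pi.add_apply]; ring

theorem lor_smul_left (a : ℝ) (x y : Mink) : lor (a • x) y = a * lor x y := by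
  simp only [lor, Pi.smul_apply, smul_eq_mul]; ring

theorem lor_comm (x y : Mink) : lor x y = lor y x := by
  simp only [lor]; ring

theorem lor_add_right (x y z : Mink) : lor x (y + z) = lor x y + lor x z := by
  rw [lor_comm, lor_add_left, lor_comm y, lor_comm z]

theorem lor_smul_right (a : ℝ) (x y : Mink) : lor x (a • y) = a * lor x y := by
  rw [lor_comm, lor_smul_left, lor_comm y]

theorem ContDiffOn.lor {E : Type*} [NormedAddCommGroup E] [NormedSpace ℝ E] {a b : E → Mink}
    {s : Set E} (ha : ContDiffOn ℝ ∞ a s) (hb : ContDiffOn ℝ ∞ b s) :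
    ContDiffOn ℝ ∞ (fun x => lor (a x) (b x)) s := by
  have ha' := contDiffOn_pi.1 ha
  have hb' := contDiffOn_pi.1 hb
  exact (((ha' 0).mul (hb' 0)).neg.add ((ha' 1).mul (hb' 1))).add ((ha' 2).mul (hb' 2))

theorem HasDerivAt.lor {a b : ℝ → Mink} {a' b' : Mink} {u : ℝ} (ha : HasDerivAt a a' u)
    (hb : HasDerivAt b b' u) :
    HasDerivAt (fun x => lor (a x) (b x)) (lor a' (b u) + lor (a u) b') u := by
  have ha := hasDerivAt_pi.1 ha
  have hb := hasDerivAt_pi.1 hb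
  refine ((((ha 0).mul (hb 0)).neg.add ((ha 1).mul (hb 1))).add ((ha 2).mul (hb 2))).congr_deriv ?_
  simp only [MixedSurface.lor]
  ring

theorem apply_zero_ne_zero_of_lor_self {v : Mink} (h0 : v ≠ 0) (h : lor v v = 0) : v 0 ≠ 0 := by
  intro hv
  simp only [lor, hv] at h
  refine h0 (funext fun i => ?_)
  fin_cases i
  · exact hv
  · show v 1 = 0; nlinarith [sq_nonneg (v 1), sq_nonneg (v 2)]
  · show v 2 = 0; nlinarith [sq_nonneg (v 1), sq_nonneg (v 2)]

end Lorentz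

/-! ### Lightcone pedals -/

section Pedal

/-- The spacelike unit vector `(0, -v₂, v₁)` tangent to the circle `v₀ = 1`, `v₁ ^ 2 + v₂ ^ 2 = 1`
of null directions at `v`. -/
def circleTangent (v : Mink) : Mink := ![0, -v 2, v 1]

/-- The angular velocity `v₁ v₂' - v₂ v₁'` of a curve `v` of normalized null vectors. -/
noncomputable def angularVelocity (v : ℝ → Mink) (u : ℝ) : ℝ :=
  v u 1 * deriv v u 2 - v u 2 * deriv v u 1

/-- A unit vector orthogonal to a normalized null vector `v` is not orthogonal to the circle of null
directions at `v`. -/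
theorem lor_circleTangent_sq {e v : Mink} (h0 : v 0 = 1) (hv : lor v v = 0) (he : lor e e = 1)
    (hev : lor e v = 0) : lor e (circleTangent v) ^ 2 = 1 := by
  simp only [lor, circleTangent, h0] at *
  simp only [Matrix.cons_val]
  have h1 : e 0 = e 1 * v 1 + e 2 * v 2 := by linarith
  have h2 : v 2 * v 2 = 1 - v 1 * v 1 := by linarith
  rw [h1] at he
  linear_combination he + (e 1 ^ 2 + e 2 ^ 2) * h2

theorem ContDiffOn.circleTangent {v : ℝ → Mink} {s : Set ℝ} (hv : ContDiffOn ℝ ∞ v s) :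
    ContDiffOn ℝ ∞ (fun u => circleTangent (v u)) s := by
  have hv' := contDiffOn_pi.1 hv
  refine contDiffOn_pi.2 fun i => ?_
  fin_cases i
  · exact contDiffOn_const
  · exact (hv' 2).neg
  · exact hv' 1

theorem ContDiffOn.angularVelocity {v : ℝ → Mink} {s : Set ℝ} (hs : IsOpen s)
    (hv : ContDiffOn ℝ ∞ v s) : ContDiffOn ℝ ∞ (angularVelocity v) s := by
  have hv' := contDiffOn_pi.1 hv
  have hd := contDiffOn_pi.1 (hv.deriv_of_isOpen (m := ∞) hs (by simp))
  exact ((hv' 1).mul (hd 2)).sub ((hv' 2).mul (hd 1))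

theorem HasDerivAt.circleTangent {v : ℝ → Mink} {v' : Mink} {u : ℝ} (hv : HasDerivAt v v' u) :
    HasDerivAt (fun u => circleTangent (v u)) (circleTangent v') u := by
  have hv' := hasDerivAt_pi.1 hv
  refine hasDerivAt_pi.2 fun i => ?_
  fin_cases i
  · exact hasDerivAt_const _ _
  · exact (hv' 2).neg
  · exact hv' 1

/-- A curve of normalized null vectors moves along the circle of null directions. -/
theorem deriv_eq_angularVelocity_smul {v : ℝ → Mink} {s : Set ℝ} (hs : IsOpen s)
    (hv : ContDiffOn ℝ ∞ v s) (h0 : ∀ u ∈ s, v u 0 = 1) (hnull : ∀ u ∈ s, lor (v u) (v u) = 0)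
    {u : ℝ} (hu : u ∈ s) : deriv v u = angularVelocity v u • circleTangent (v u) := by
  have hd := ((hv.contDiffAt (hs.mem_nhds hu)).differentiableAt (by simp)).hasDerivAt
  have h1 : deriv v u 0 = 0 := by
    refine (hasDerivAt_pi.1 hd 0).unique ((hasDerivAt_const u (1 : ℝ)).congr_of_eventuallyEq ?_)
    filter_upwards [hs.mem_nhds hu] with x hx using h0 x hx
  have h2 : 2 * lor (v u) (deriv v u) = 0 := by
    have := (hd.lor hd).unique ((hasDerivAt_const u (0 : ℝ)).congr_of_eventuallyEq (by
      filter_upwards [hs.mem_nhds hu] with x hx using hnull x hx))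
    rw [lor_comm (deriv v u)] at this
    linarith
  have h3 := hnull u hu
  simp only [lor, h1, h0 u hu] at h2 h3
  ext i
  simp only [angularVelocity, circleTangent, Pi.smul_apply, smul_eq_mul]
  fin_cases i
  · simp [h1]
  · show deriv v u 1 = (v u 1 * deriv v u 2 - v u 2 * deriv v u 1) * -v u 2
    linear_combination (-deriv v u 1) * h3 + v u 1 / 2 * h2
  · show deriv v u 2 = (v u 1 * deriv v u 2 - v u 2 * deriv v u 1) * v u 1
    linear_combination (-deriv v u 2) * h3 + v u 2 / 2 * h2

/-- For a null normal field `V` of a unit speed spacelike curve `c`, the velocity of the lightcone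
pedal and the function `⟨c'', V⟩` have a common factor `σ`, the angular velocity of the direction
of `V`. If `⟨c, V⟩ ≠ 0` at `t`, the remaining factor `m` of the velocity does not vanish at `t`,
and it turns away from its direction if `σ t = 0`. -/
theorem exists_lightconePedal_factorization {c V : ℝ → Mink} {s : Set ℝ} (hs : IsOpen s)
    (hc : ContDiffOn ℝ ∞ c s) (hV : ContDiffOn ℝ ∞ V s)
    (hunit : ∀ u ∈ s, lor (deriv c u) (deriv c u) = 1) (horth : ∀ u ∈ s, lor (deriv c u) (V u) = 0)
    (hnull : ∀ u ∈ s, lor (V u) (V u) = 0) (hne : ∀ u ∈ s, V u ≠ 0) {t : ℝ} (ht : t ∈ s)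
    (hct : lor (c t) (V t) ≠ 0) :
    ∃ (σ g : ℝ → ℝ) (m : ℝ → Mink), ContDiffOn ℝ ∞ (lightconePedal c V) s ∧
      ContDiffOn ℝ ∞ σ s ∧ ContDiffOn ℝ ∞ g s ∧ ContDiffOn ℝ ∞ m s ∧
      (∀ u ∈ s, deriv (lightconePedal c V) u = σ u • m u) ∧
      (∀ u ∈ s, lor (deriv (deriv c) u) (V u) = σ u * g u) ∧
      g t ≠ 0 ∧ m t ≠ 0 ∧ (σ t = 0 → LinearIndependent ℝ ![m t, deriv m t]) := by
  have hV0 : ∀ u ∈ s, V u 0 ≠ 0 := fun u hu => apply_zero_ne_zero_of_lor_self (hne u hu) (hnull u hu)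
  let v : ℝ → Mink := fun u => tilde (V u)
  have hv : ContDiffOn ℝ ∞ v s := ((contDiffOn_pi.1 hV 0).inv hV0).smul hV
  have hv0 : ∀ u ∈ s, v u 0 = 1 := fun u hu => by simp [v, tilde, hV0 u hu]
  have hvV : ∀ u ∈ s, V u = V u 0 • v u := fun u hu => by
    simp [v, tilde, smul_smul, hV0 u hu]
  have hvnull : ∀ u ∈ s, lor (v u) (v u) = 0 := fun u hu => by
    simp [v, tilde, lor_smul_left, lor_smul_right, hnull u hu]
  have hvorth : ∀ u ∈ s, lor (deriv c u) (v u) = 0 := fun u hu => by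
    simp [v, tilde, lor_smul_right, horth u hu]
  have hd : ∀ {a : ℝ → Mink}, ContDiffOn ℝ ∞ a s → ∀ u ∈ s, HasDerivAt a (deriv a u) u :=
    fun ha u hu => ((ha.contDiffAt (hs.mem_nhds hu)).differentiableAt (by simp)).hasDerivAt
  have hc' : ContDiffOn ℝ ∞ (deriv c) s := hc.deriv_of_isOpen hs (by simp)
  have hT := hv.circleTangent
  let m : ℝ → Mink := fun u => lor (c u) (circleTangent (v u)) • v u
    + lor (c u) (v u) • circleTangent (v u)
  have hm : ContDiffOn ℝ ∞ m s := ((hc.lor hT).smul hv).add ((hc.lor hv).smul hT)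
  have hvd : ∀ u ∈ s, deriv v u = angularVelocity v u • circleTangent (v u) := fun u hu =>
    deriv_eq_angularVelocity_smul hs hv hv0 hvnull hu
  have het : lor (deriv c t) (circleTangent (v t)) ≠ 0 := fun h => by
    have := lor_circleTangent_sq (hv0 t ht) (hvnull t ht) (hunit t ht) (hvorth t ht)
    simp [h] at this
  have hcv : lor (c t) (v t) ≠ 0 := by
    simp [v, tilde, lor_smul_right, hct, hV0 t ht]
  -- The vectors `v` and `circleTangent v` are independent: they differ in the time coordinate.
  have hind : ∀ x y : ℝ, x • v t + y • circleTangent (v t) = 0 → x = 0 ∧ y = 0 := by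
    intro x y hxy
    have h0 := congrFun hxy 0
    have h1 := congrFun hxy 1
    have h2 := congrFun hxy 2
    have h3 := hvnull t ht
    simp only [circleTangent, Pi.add_apply, Pi.smul_apply, smul_eq_mul, Pi.zero_apply,
      Matrix.cons_val, hv0 t ht, lor] at h0 h1 h2 h3
    have hx : x = 0 := by linarith
    subst hx
    refine ⟨rfl, ?_⟩
    linear_combination v t 1 * h2 - v t 2 * h1 - y * h3
  refine ⟨angularVelocity v, fun u => -(V u 0 * lor (deriv c u) (circleTangent (v u))), m,
    (hc.lor hv).smul hv, hv.angularVelocity hs,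
    ((contDiffOn_pi.1 hV 0).mul (hc'.lor hT)).neg, hm, fun u hu => ?_, fun u hu => ?_,
    neg_ne_zero.2 (mul_ne_zero (hV0 t ht) het), fun h => hcv (hind _ _ h).2, fun hσ => ?_⟩
  · refine (((hd hc u hu).lor (hd hv u hu)).smul (hd hv u hu)).deriv.trans ?_
    rw [hvorth u hu, hvd u hu, lor_smul_right]
    simp only [m]
    module
  · have hVd : HasDerivAt V (V u 0 • deriv v u + deriv V u 0 • v u) u := by
      refine ((hasDerivAt_pi.1 (hd hV u hu) 0).smul (hd hv u hu)).congr_of_eventuallyEq ?_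
      filter_upwards [hs.mem_nhds hu] with x hx using hvV x hx
    have h1 := ((hd hc' u hu).lor hVd).unique ((hasDerivAt_const u (0 : ℝ)).congr_of_eventuallyEq (by
      filter_upwards [hs.mem_nhds hu] with x hx using horth x hx))
    rw [lor_add_right, lor_smul_right, lor_smul_right, hvorth u hu, hvd u hu, lor_smul_right] at h1
    linear_combination h1
  · have hvd0 : HasDerivAt v 0 t := by
      have := hd hv t ht
      rwa [hvd t ht, hσ, zero_smul] at this
    have hT0 : HasDerivAt (fun u => circleTangent (v u)) 0 t := by
      have := hvd0.circleTangent
      rwa [show circleTangent 0 = 0 by ext i; fin_cases i <;> simp [circleTangent]] at this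
    have hm' : deriv m t = lor (deriv c t) (circleTangent (v t)) • v t := by
      refine ((((hd hc t ht).lor hT0).smul hvd0).add (((hd hc t ht).lor hvd0).smul hT0)).deriv.trans ?_
      rw [hvorth t ht]
      simp [lor]
    rw [hm', LinearIndependent.pair_iff]
    intro x y hxy
    have h1 := hind (x * lor (c t) (circleTangent (v t)) + y * lor (deriv c t) (circleTangent (v t)))
      (x * lor (c t) (v t)) (by rw [← hxy]; simp only [m]; module)
    have hx : x = 0 := (mul_eq_zero.1 h1.2).resolve_right hcv
    rw [hx, zero_mul, zero_add] at h1
    exact ⟨hx, (mul_eq_zero.1 h1.1).resolve_right het⟩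

/-- The singularity and the cusp of a lightcone pedal, in terms of a multiple `κ` of `⟨c'', V⟩` by a
factor which is differentiable and nonzero at the parameter. -/
theorem lightconePedal_singular_and_cusp_iff {c V : ℝ → Mink} {s : Set ℝ} (hs : IsOpen s)
    (hc : ContDiffOn ℝ ∞ c s) (hV : ContDiffOn ℝ ∞ V s)
    (hunit : ∀ u ∈ s, lor (deriv c u) (deriv c u) = 1) (horth : ∀ u ∈ s, lor (deriv c u) (V u) = 0)
    (hnull : ∀ u ∈ s, lor (V u) (V u) = 0) (hne : ∀ u ∈ s, V u ≠ 0) (h0 : (0 : ℝ) ∈ s)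
    (hc0 : lor (c 0) (V 0) ≠ 0) {κ ρ : ℝ → ℝ}
    (hκ : ∀ u, κ u = ρ u * lor (deriv (deriv c) u) (V u)) (hρ : DifferentiableAt ℝ ρ 0)
    (hρ0 : ρ 0 ≠ 0) :
    (IsSingularParam (lightconePedal c V) 0 ↔ κ 0 = 0) ∧
      (HasCuspAt (lightconePedal c V) 0 ↔ κ 0 = 0 ∧ deriv κ 0 ≠ 0) := by
  obtain ⟨σ, g, m, hLP, hσ, hg, hm, hd, hα, hg0, hm0, hind⟩ :=
    exists_lightconePedal_factorization hs hc hV hunit horth hnull hne h0 hc0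
  have hs0 := hs.mem_nhds h0
  have hdiff := (hLP.contDiffAt hs0).differentiableAt (by simp)
  have hd' : deriv (lightconePedal c V) =ᶠ[𝓝 0] fun u => σ u • m u := by
    filter_upwards [hs0] with u hu using hd u hu
  have hσ0 := hσ.contDiffAt hs0
  have hκσ : κ 0 = 0 ↔ σ 0 = 0 := by
    rw [hκ, hα 0 h0]; simp [hρ0, hg0]
  have hκ' : σ 0 = 0 → (deriv κ 0 ≠ 0 ↔ deriv σ 0 ≠ 0) := fun h => by
    have h1 : κ =ᶠ[𝓝 0] fun u => σ u * (ρ u * g u) := by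
      filter_upwards [hs0] with u hu
      rw [hκ, hα u hu]; ring
    have h2 := ((hσ0.differentiableAt (by simp)).hasDerivAt.mul (hρ.hasDerivAt.mul
      ((hg.contDiffAt hs0).differentiableAt (by simp)).hasDerivAt)).congr_of_eventuallyEq h1
    rw [h2.deriv, h]
    simp [hρ0, hg0]
  have hm1 := hm.contDiffAt hs0
  refine ⟨?_, fun h => ?_, fun ⟨h1, h2⟩ => ?_⟩
  · rw [IsSingularParam, hd 0 h0, hκσ]
    simp [hdiff, hm0]
  · obtain ⟨-, h1, h2⟩ := h.deriv_eq_zero_and_deriv_deriv_ne_zero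
    rw [hd 0 h0, smul_eq_zero, or_iff_left hm0] at h1
    rw [deriv_deriv_of_deriv_eq_smul hd' hσ0 hm1 h1] at h2
    exact ⟨hκσ.2 h1, (hκ' h1).2 (left_ne_zero_of_smul h2)⟩
  · have h3 := hκσ.1 h1
    have h4 := (hκ' h3).1 h2
    refine hasCuspAt_zero_of_linearIndependent hs0 hLP (by rw [hd 0 h0, h3, zero_smul]) ?_
    rw [deriv_deriv_of_deriv_eq_smul hd' hσ0 hm1 h3,
      deriv_deriv_deriv_of_deriv_eq_smul hd' hσ0 hm1 h3, LinearIndependent.pair_iff]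
    intro x y hxy
    have h5 := LinearIndependent.pair_iff.1 (hind h3) (x * deriv σ 0 + y * deriv (deriv σ) 0)
      (y * (2 * deriv σ 0)) (by rw [← hxy]; module)
    have hy : y = 0 := by simpa [h4] using h5.2
    have hx := h5.1
    rw [hy, zero_mul, add_zero] at hx
    exact ⟨(mul_eq_zero.1 hx).resolve_right h4, hy⟩

end Pedal

/-! ### The invariant `β` and its cube root -/

section Beta

variable {f : Plane → Mink} {U : Set Plane}

theorem MixedSurface.IsSmoothImmersion.contDiffOn_inducedMetric (hf : IsSmoothImmersion f U)
    {v w : Plane → Plane}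
    (hv : ContDiffOn ℝ ∞ v U) (hw : ContDiffOn ℝ ∞ w U) :
    ContDiffOn ℝ ∞ (fun q => inducedMetric f q (v q) (w q)) U := by
  have h := hf.smooth.fderiv_of_isOpen (m := ∞) hf.isOpen (by simp)
  exact (h.clm_apply hv).lor (h.clm_apply hw)

theorem inducedMetric_mul_sub_sq (q v w : Plane) :
    inducedMetric f q v v * inducedMetric f q w w - inducedMetric f q v w ^ 2
      = (v 0 * w 1 - v 1 * w 0) ^ 2 * discriminant f q := by
  have h : ∀ v : Plane, fderiv ℝ f q v = v 0 • fderiv ℝ f q ![1, 0] + v 1 • fderiv ℝ f q ![0, 1] := by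
    intro v
    rw [← map_smul, ← map_smul, ← map_add]
    congr 1
    ext i
    fin_cases i <;> simp
  simp only [discriminant, MixedSurface.inducedMetric, h v, h w, lor_add_left, lor_add_right,
    lor_smul_left, lor_smul_right]
  rw [lor_comm (fderiv ℝ f q ![0, 1]) (fderiv ℝ f q ![1, 0])]
  ring

variable {ε : ℝ} {γ : ℝ → Plane} {L N : ℝ → Mink} {l : Plane → Plane}

theorem contDiffAt_beta (hf : IsSmoothImmersion f U) (hγ : IsLightlikeLocusParam f U ε γ)
    (hl : IsNullFieldFor f U ε γ L l) {u : ℝ} (hu : u ∈ Set.Ioo (-ε) ε) :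
    ContDiffAt ℝ ∞ (beta f γ l) u := by
  have hU := hf.isOpen.mem_nhds (hγ.mem u hu).1
  have hγu := hγ.smooth.contDiffAt (isOpen_Ioo.mem_nhds hu)
  have h := ((hf.contDiffOn_inducedMetric hl.smooth hl.smooth).contDiffAt hU).fderiv_right
    (m := ∞) (by simp)
  exact (h.comp u hγu).clm_apply ((hl.smooth.contDiffAt hU).comp u hγu)

/-- At a lightlike point of the first kind the invariant `β` does not vanish. Indeed, with `a = γ'`,
the Gram determinant of `a` and `l` is the discriminant of the metric multiplied by the square of a
determinant which is not zero; differentiate this in the direction of `l`. -/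
theorem beta_ne_zero (hf : IsSmoothImmersion f U) (hfirst : ∀ q ∈ lightlikeSet f U, IsFirstKind f q)
    (hγ : IsLightlikeLocusParam f U ε γ) (hframe : IsLightlikeFrame f ε γ L N)
    (hl : IsNullFieldFor f U ε γ L l) {u : ℝ} (hu : u ∈ Set.Ioo (-ε) ε) : beta f γ l u ≠ 0 := by
  set q := γ u with hq
  have hqU : q ∈ U := (hγ.mem u hu).1
  have hU := hf.isOpen.mem_nhds hqU
  let a : Plane := deriv γ u
  have ha : fderiv ℝ f q a = deriv (f ∘ γ) u := by
    have h1 := ((hγ.smooth.contDiffAt (isOpen_Ioo.mem_nhds hu)).differentiableAt (by simp)).hasDerivAt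
    have h2 := ((hf.smooth.contDiffAt hU).differentiableAt (by simp)).hasFDerivAt
    exact (h2.comp_hasDerivAt u h1).deriv.symm
  have hL := hl.map_eq u hu
  rw [← hq] at hL
  have hA : inducedMetric f q a a = 1 := by rw [inducedMetric, ha, hγ.unit u hu]
  have hB : inducedMetric f q (l q) (l q) = 0 := by rw [inducedMetric, hL, hframe.L_L u hu]
  have hC : inducedMetric f q a (l q) = 0 := by rw [inducedMetric, ha, hL, hframe.e_L u hu]
  have hl0 : l q ≠ 0 := fun h => by
    have h1 := hframe.L_N u hu
    rw [← hL, h, map_zero] at h1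
    simp [lor] at h1
  have hnull : IsNullDirection f q (l q) := by
    refine ⟨hl0, fun w => ?_⟩
    have hw : fderiv ℝ f q w ∈ tangentPlane f q := ⟨w, rfl⟩
    rw [hq, ← hframe.span_eq u hu, Submodule.mem_span_pair, ← hq] at hw
    obtain ⟨x, y, hxy⟩ := hw
    rw [inducedMetric, hL, ← hxy, lor_add_right, lor_smul_right, lor_smul_right, lor_comm,
      hframe.e_L u hu, hframe.L_L u hu]
    ring
  have hdet : a 0 * l q 1 - a 1 * l q 0 ≠ 0 := fun h => by
    -- Otherwise `a` and `l` are proportional, whereas `⟨a, a⟩ = 1` and `⟨a, l⟩ = 0`.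
    have key : ∀ i, l q i = 0 := fun i => by
      have h1 : l q i • a = a i • l q := by
        ext j
        fin_cases i <;> fin_cases j <;> simp <;> linarith
      have h2 := congrArg (fun v => inducedMetric f q a v) h1
      simp only [inducedMetric, map_smul, lor_smul_right] at h2 hA hC
      simpa [hA, hC] using h2
    exact hl0 (funext key)
  have hgram := fun q => inducedMetric_mul_sub_sq (f := f) q a (l q)
  have hdisc : discriminant f q = 0 := by
    have := hgram q
    rw [hA, hB, hC] at this
    have h2 : (a 0 * l q 1 - a 1 * l q 0) ^ 2 * discriminant f q = 0 := by rw [← this]; ring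
    exact (mul_eq_zero.1 h2).resolve_left (pow_ne_zero 2 hdet)
  have hd : ∀ {h : Plane → ℝ}, ContDiffOn ℝ ∞ h U → HasFDerivAt h (fderiv ℝ h q) q := fun h =>
    ((h.contDiffAt hU).differentiableAt (by simp)).hasFDerivAt
  have hls := contDiffOn_pi.1 hl.smooth
  have dA := hd (hf.contDiffOn_inducedMetric (contDiffOn_const (c := a)) (contDiffOn_const (c := a)))
  have dB := hd (hf.contDiffOn_inducedMetric hl.smooth hl.smooth)
  have dC := hd (hf.contDiffOn_inducedMetric (contDiffOn_const (c := a)) hl.smooth)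
  have dD := hd (((contDiffOn_const (c := a 0)).mul (hls 1)).sub
    ((contDiffOn_const (c := a 1)).mul (hls 0)))
  have hdiscs : ContDiffOn ℝ ∞ (discriminant f) U :=
    ((hf.contDiffOn_inducedMetric contDiffOn_const contDiffOn_const).mul
      (hf.contDiffOn_inducedMetric contDiffOn_const contDiffOn_const)).sub
      ((hf.contDiffOn_inducedMetric contDiffOn_const contDiffOn_const).pow 2)
  have dE := hd hdiscs
  have h1 := ((dA.mul dB).sub (dC.pow 2))
  have h2 := (dD.pow 2).mul dE
  have h3 := h1.unique (h2.congr_of_eventuallyEq (Eventually.of_forall hgram))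
  have h4 := congrArg (fun φ : Plane →L[ℝ] ℝ => φ (l q)) h3
  -- Of the terms of the product rule only two survive, because `⟨L, L⟩`, `⟨γ', l⟩` and the
  -- discriminant vanish at `q`.
  simp [hA, hB, hC, hdisc] at h4
  rw [beta, ← hq, h4]
  exact mul_ne_zero (pow_ne_zero 2 hdet) ((hfirst q (hγ.mem u hu)).2 _ hnull)

theorem cbrt_ne_zero {x : ℝ} (hx : x ≠ 0) : cbrt x ≠ 0 := fun h => hx (by
  rw [← cbrt_pow_three x, h]; norm_num)

theorem differentiableAt_cbrt {x : ℝ} (hx : x ≠ 0) : DifferentiableAt ℝ cbrt x := by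
  rcases hx.lt_or_gt with h | h
  · have h1 : cbrt =ᶠ[𝓝 x] fun y => -(-y) ^ (1 / 3 : ℝ) := by
      filter_upwards [Iio_mem_nhds h] with y hy
      rw [cbrt, sign_neg hy, abs_of_neg hy]
      simp
    refine (DifferentiableAt.neg ?_).congr_of_eventuallyEq h1
    exact differentiableAt_id.neg.rpow_const (Or.inl (by simpa using hx))
  · have h1 : cbrt =ᶠ[𝓝 x] fun y => y ^ (1 / 3 : ℝ) := by
      filter_upwards [Ioi_mem_nhds h] with y hy
      rw [cbrt, sign_pos hy, abs_of_pos hy]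
      simp
    exact (differentiableAt_id.rpow_const (Or.inl hx)).congr_of_eventuallyEq h1

end Beta

theorem mainTheorem6 (f : Plane → Mink) (U : Set Plane) (ε : ℝ) (γ : ℝ → Plane)
    (L N : ℝ → Mink) (l : Plane → Plane)
    (hf : IsSmoothImmersion f U)
    (hfirst : ∀ q ∈ lightlikeSet f U, IsFirstKind f q)
    (hγ : IsLightlikeLocusParam f U ε γ)
    (hframe : IsLightlikeFrame f ε γ L N)
    (hl : IsNullFieldFor f U ε γ L l) :
    (lor (f (γ 0)) (L 0) ≠ 0 →
      (IsSingularParam (lightconePedal (f ∘ γ) L) 0 ↔ kappaL f γ L l 0 = 0) ∧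
      (HasCuspAt (lightconePedal (f ∘ γ) L) 0 ↔
        kappaL f γ L l 0 = 0 ∧ deriv (kappaL f γ L l) 0 ≠ 0)) ∧
    (lor (f (γ 0)) (N 0) ≠ 0 →
      (IsSingularParam (lightconePedal (f ∘ γ) N) 0 ↔ kappaN f γ N l 0 = 0) ∧
      (HasCuspAt (lightconePedal (f ∘ γ) N) 0 ↔
        kappaN f γ N l 0 = 0 ∧ deriv (kappaN f γ N l) 0 ≠ 0)) := by
  have h0 : (0 : ℝ) ∈ Set.Ioo (-ε) ε := ⟨neg_lt_zero.2 hγ.pos, hγ.pos⟩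
  have hc : ContDiffOn ℝ ∞ (f ∘ γ) (Set.Ioo (-ε) ε) :=
    hf.smooth.comp hγ.smooth fun u hu => (hγ.mem u hu).1
  have hβ0 := beta_ne_zero hf hfirst hγ hframe hl h0
  have hβ : DifferentiableAt ℝ (fun u => cbrt (beta f γ l u)) 0 :=
    (differentiableAt_cbrt hβ0).comp 0 ((contDiffAt_beta hf hγ hl h0).differentiableAt (by simp))
  have hL0 : ∀ u ∈ Set.Ioo (-ε) ε, L u ≠ 0 := fun u hu h => by
    have := hframe.L_N u hu
    simp [h, lor] at this
  have hN0 : ∀ u ∈ Set.Ioo (-ε) ε, N u ≠ 0 := fun u hu h => by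
    have := hframe.L_N u hu
    simp [h, lor] at this
  exact ⟨fun h => lightconePedal_singular_and_cusp_iff isOpen_Ioo hc hframe.smooth_L hγ.unit
      hframe.e_L hframe.L_L hL0 h0 h (fun _ => rfl) (hβ.inv (cbrt_ne_zero hβ0))
      (inv_ne_zero (cbrt_ne_zero hβ0)),
    fun h => lightconePedal_singular_and_cusp_iff isOpen_Ioo hc hframe.smooth_N hγ.unit
      hframe.e_N hframe.N_N hN0 h0 h (fun _ => rfl) hβ (cbrt_ne_zero hβ0)⟩
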